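/- Let $\mathcal{H}$ be a complex Hilbert space, let $L$ be a unitary operator on $\mathcal{H}$ whose spectrum is the whole unit circle $\mathbb{S}^1\subseteq\mathbb{C}$, and let $\mathcal{K}$ denote the set of compact operators on $\mathcal{H}$. For a Borel set $S\subseteq\mathbb{C}$ let $\Lambda_S=\chi_S(L)$ be the spectral projection of $L$ associated with $S$. Then a bounded operator $A$ on $\mathcal{H}$ satisfies $[A,L]=AL-LA\in\mathcal{K}$ if and only if $$\Lambda_I\,A\,\Lambda_J\in\mathcal{K}$$ for all arcs $I,J\subseteq\mathbb{S}^1$ with $\mathrm{dist}(I,J)=\inf_{x\in I,\,y\in J}|x-y|>0$. Here an arc is the image under $t\mapsto e^{it}$ of an interval of $\mathbb{R}$, with or without its endpoints. -/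

import Mathlib

open MeasureTheory CompactlySupported
open scoped InnerProductSpace ENNReal ComplexOrder

namespace SpectralCalculus

noncomputable section

section Measures

variable {X : Type*} [TopologicalSpace X] [MeasurableSpace X] [BorelSpace X]
  [HasOuterApproxClosed X]

/-- A linear relation between finite Borel measures that holds after integration of every bounded
continuous function holds on every set. -/
lemma sum_mul_measure_real_eq_zero {ι : Type*} [Fintype ι] (m : ι → Measure X)
    [∀ i, IsFiniteMeasure (m i)] (a : ι → ℝ)
    (h : ∀ f : BoundedContinuousFunction X ℝ, ∑ i, a i * ∫ t, f t ∂(m i) = 0) (S : Set X) :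
    ∑ i, a i * (m i).real S = 0 := by
  have key : ∑ i, (a i).toNNReal • m i = ∑ i, (-a i).toNNReal • m i := by
    refine ext_of_forall_integral_eq_of_IsFiniteMeasure fun f => ?_
    have e : ∀ b : ι → ℝ, ∫ t, f t ∂(∑ i, (b i).toNNReal • m i) =
        ∑ i, ((b i).toNNReal : ℝ) * ∫ t, f t ∂(m i) := fun b => by
      rw [integral_finsetSum_measure fun i _ => f.integrable _]
      simp [integral_smul_nnreal_measure, NNReal.smul_def]
    rw [e, e, ← sub_eq_zero, ← Finset.sum_sub_distrib, ← h f]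
    refine Finset.sum_congr rfl fun i _ => ?_
    rw [← sub_mul, Real.coe_toNNReal', Real.coe_toNNReal', max_zero_sub_eq_self]
  have e : ∀ b : ι → ℝ, (∑ i, (b i).toNNReal • m i).real S =
      ∑ i, ((b i).toNNReal : ℝ) * (m i).real S := fun b => by
    simp only [Measure.real, Measure.finsetSum_apply]
    rw [ENNReal.toReal_sum fun i _ => measure_ne_top _ _]
    refine Finset.sum_congr rfl fun i _ => ?_
    rw [Measure.smul_apply, ENNReal.smul_def, smul_eq_mul, ENNReal.toReal_mul, ENNReal.coe_toReal]
  have := e a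
  rw [key, e, eq_comm, ← sub_eq_zero, ← Finset.sum_sub_distrib] at this
  rw [← this]
  refine Finset.sum_congr rfl fun i _ => ?_
  rw [← sub_mul, Real.coe_toNNReal', Real.coe_toNNReal', max_zero_sub_eq_self]

end Measures

variable {H : Type*} [NormedAddCommGroup H] [InnerProductSpace ℂ H] [CompleteSpace H]

/-- A real continuous function on the spectrum, regarded as a complex one. -/
def toComplexFun {K : Set ℂ} (f : C(K, ℝ)) : C(K, ℂ) :=
  ⟨fun t => (f t : ℂ), by fun_prop⟩

/-- For a normal operator `N` and a vector `x`, the positive functional `f ↦ ⟪x, f(N) x⟫` on real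
continuous functions on the spectrum of `N` (continuous functional calculus). -/
def spectralFunctional (N : H →L[ℂ] H) [hN : IsStarNormal N] (x : H) :
    C_c(spectrum ℂ N, ℝ) →ₚ[ℝ] ℝ :=
  PositiveLinearMap.mk₀
    { toFun := fun f => (⟪x, cfcHom (R := ℂ) hN (toComplexFun f.toContinuousMap) x⟫_ℂ).re
      map_add' := fun f g => by
        have : toComplexFun (f + g).toContinuousMap =
            toComplexFun f.toContinuousMap + toComplexFun g.toContinuousMap := by
          ext t; simp [toComplexFun]
        rw [this, map_add]
        simp
      map_smul' := fun c f => by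
        have : toComplexFun (c • f).toContinuousMap =
            (c : ℂ) • toComplexFun f.toContinuousMap := by
          ext t; simp [toComplexFun]
        rw [this, map_smul]
        simp }
    (fun f hf => by
      have h0 : (0 : C(spectrum ℂ N, ℂ)) ≤ toComplexFun f.toContinuousMap := by
        intro t
        have : 0 ≤ f t := hf t
        simpa [toComplexFun] using this
      have h1 := (cfcHom_nonneg_iff (R := ℂ) hN).2 h0
      rw [ContinuousLinearMap.nonneg_iff_isPositive] at h1
      exact h1.re_inner_nonneg_right x)

/-- The scalar spectral measure `μ_x` of a normal operator `N` at `x`: the Borel measure on the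
spectrum of `N` with `∫ f dμ_x = ⟪x, f(N) x⟫` for all continuous `f`. -/
def scalarSpectralMeasure (N : H →L[ℂ] H) [IsStarNormal N] (x : H) : Measure (spectrum ℂ N) :=
  RealRMK.rieszMeasure (spectralFunctional N x)

instance (N : H →L[ℂ] H) [IsStarNormal N] (x : H) :
    IsFiniteMeasure (scalarSpectralMeasure N x) := by
  unfold scalarSpectralMeasure; infer_instance

lemma integral_scalarSpectralMeasure (N : H →L[ℂ] H) [hN : IsStarNormal N] (x : H)
    (f : C(spectrum ℂ N, ℝ)) :
    ((∫ t, f t ∂(scalarSpectralMeasure N x) : ℝ) : ℂ) =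
      ⟪x, cfcHom (R := ℂ) hN (toComplexFun f) x⟫_ℂ := by
  have h := RealRMK.integral_rieszMeasure (spectralFunctional N x)
    (CompactlySupportedContinuousMap.continuousMapEquiv f)
  have h2 : ∫ t, f t ∂(scalarSpectralMeasure N x) =
    (⟪x, cfcHom (R := ℂ) hN (toComplexFun f) x⟫_ℂ).re := h
  have hsa : IsSelfAdjoint (cfcHom (R := ℂ) hN (toComplexFun f)) := by
    rw [isSelfAdjoint_iff, ← map_star]
    congr 1
    ext t
    simp [toComplexFun]
  rw [h2]
  exact (ContinuousLinearMap.isSelfAdjoint_iff_isSymmetric.1 hsa).coe_re_inner_self_apply x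

lemma scalarSpectralMeasure_real_univ (N : H →L[ℂ] H) [IsStarNormal N] (x : H) :
    (scalarSpectralMeasure N x).real Set.univ = ‖x‖ ^ 2 := by
  have h := integral_scalarSpectralMeasure N x 1
  have h1 : toComplexFun (1 : C(spectrum ℂ N, ℝ)) = 1 := by ext t; simp [toComplexFun]
  rw [h1, map_one] at h
  simp only [ContinuousMap.one_apply, integral_const, smul_eq_mul, mul_one,
    one_apply_eq_self, inner_self_eq_norm_sq_to_K] at h
  rw [← Complex.ofReal_inj, h]
  simp

/-- Linear relations between quadratic forms of operators pass to the scalar spectral measures. -/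
lemma sum_mul_scalarSpectralMeasure (N : H →L[ℂ] H) [hN : IsStarNormal N] {ι : Type*} [Fintype ι]
    (c : ι → ℂ) (x : ι → H) (h : ∀ T : H →L[ℂ] H, ∑ i, c i * ⟪x i, T (x i)⟫_ℂ = 0)
    (S : Set (spectrum ℂ N)) :
    ∑ i, c i * ((scalarSpectralMeasure N (x i)).real S : ℂ) = 0 := by
  have h' : ∀ f : BoundedContinuousFunction (spectrum ℂ N) ℝ,
      ∑ i, c i * ((∫ t, f t ∂(scalarSpectralMeasure N (x i)) : ℝ) : ℂ) = 0 := fun f => by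
    rw [← h (cfcHom (R := ℂ) hN (toComplexFun f.toContinuousMap))]
    refine Finset.sum_congr rfl fun i _ => ?_
    rw [← integral_scalarSpectralMeasure]
    rfl
  apply Complex.ext
  · simpa using sum_mul_measure_real_eq_zero (fun i => scalarSpectralMeasure N (x i))
      (fun i => (c i).re) (fun f => by simpa using congrArg Complex.re (h' f)) S
  · simpa using sum_mul_measure_real_eq_zero (fun i => scalarSpectralMeasure N (x i))
      (fun i => (c i).im) (fun f => by simpa using congrArg Complex.im (h' f)) S

/-- The polarization of `x ↦ μ_x(S)`. -/
def spectralForm (N : H →L[ℂ] H) [IsStarNormal N] (S : Set (spectrum ℂ N)) (x y : H) : ℂ :=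
  (((scalarSpectralMeasure N (x + y)).real S : ℂ) - (scalarSpectralMeasure N (x - y)).real S
    + Complex.I * (scalarSpectralMeasure N (x - Complex.I • y)).real S
    - Complex.I * (scalarSpectralMeasure N (x + Complex.I • y)).real S) / 4

/-- Linear relations between sesquilinear forms of operators pass to `spectralForm`. -/
lemma sum_mul_spectralForm (N : H →L[ℂ] H) [IsStarNormal N] {n : ℕ} (a : Fin n → ℂ)
    (x y : Fin n → H) (h : ∀ T : H →L[ℂ] H, ∑ i, a i * ⟪x i, T (y i)⟫_ℂ = 0)
    (S : Set (spectrum ℂ N)) : ∑ i, a i * spectralForm N S (x i) (y i) = 0 := by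
  have key := sum_mul_scalarSpectralMeasure N (ι := Fin n × Fin 4)
    (fun p => a p.1 * (![1, -1, Complex.I, -Complex.I] p.2 / 4))
    (fun p => x p.1 + (![1, -1, -Complex.I, Complex.I] p.2) • y p.1) (fun T => by
      rw [← h T, Fintype.sum_prod_type]
      refine Finset.sum_congr rfl fun i _ => ?_
      simp [Fin.sum_univ_four]
      ring_nf
      simp only [Complex.I_sq]
      ring) S
  rw [← key, Fintype.sum_prod_type]
  refine Finset.sum_congr rfl fun i _ => ?_
  simp [Fin.sum_univ_four, spectralForm, ← sub_eq_add_neg]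
  ring

lemma norm_spectralForm_le (N : H →L[ℂ] H) [IsStarNormal N] (S : Set (spectrum ℂ N)) (x y : H) :
    ‖spectralForm N S x y‖ ≤ ‖x‖ ^ 2 + ‖y‖ ^ 2 := by
  have q : ∀ z : H, ‖((scalarSpectralMeasure N z).real S : ℂ)‖ ≤ ‖z‖ ^ 2 := fun z => by
    rw [Complex.norm_real, Real.norm_of_nonneg measureReal_nonneg,
      ← scalarSpectralMeasure_real_univ N z]
    exact measureReal_mono (Set.subset_univ S)
  have p1 := parallelogram_law_with_norm ℂ x y
  have p2 := parallelogram_law_with_norm ℂ x (Complex.I • y)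
  have hI : ‖Complex.I • y‖ = ‖y‖ := by simp [norm_smul]
  rw [hI] at p2
  have h : ‖spectralForm N S x y‖ ≤ (‖x + y‖ ^ 2 + ‖x - y‖ ^ 2 + ‖x - Complex.I • y‖ ^ 2
      + ‖x + Complex.I • y‖ ^ 2) / 4 := by
    rw [spectralForm, norm_div, Complex.norm_ofNat]
    gcongr
    refine (norm_sub_le _ _).trans (add_le_add ((norm_add_le _ _).trans (add_le_add
      ((norm_sub_le _ _).trans (add_le_add (q _) (q _))) ?_)) ?_)
    all_goals rw [norm_mul, Complex.norm_I, one_mul]; exact q _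
  nlinarith

/-- For every set `S` there is a bounded operator `P` with `⟪x, P x⟫ = μ_x(S)` for all `x`. -/
theorem exists_spectralProjection (N : H →L[ℂ] H) [IsStarNormal N] (S : Set (spectrum ℂ N)) :
    ∃ P : H →L[ℂ] H, ∀ x, ⟪x, P x⟫_ℂ = ((scalarSpectralMeasure N x).real S : ℂ) := by
  have addL : ∀ x x' y, spectralForm N S (x + x') y =
      spectralForm N S x y + spectralForm N S x' y := fun x x' y => by
    have := sum_mul_spectralForm N ![1, -1, -1] ![x + x', x, x'] ![y, y, y] (fun T => by
      simp [Fin.sum_univ_three]) S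
    simp [Fin.sum_univ_three] at this
    linear_combination this
  have addR : ∀ x y y', spectralForm N S x (y + y') =
      spectralForm N S x y + spectralForm N S x y' := fun x y y' => by
    have := sum_mul_spectralForm N ![1, -1, -1] ![x, x, x] ![y + y', y, y'] (fun T => by
      simp [Fin.sum_univ_three]) S
    simp [Fin.sum_univ_three] at this
    linear_combination this
  have smulL : ∀ (c : ℂ) x y, spectralForm N S (c • x) y =
      starRingEnd ℂ c • spectralForm N S x y := fun c x y => by
    have := sum_mul_spectralForm N ![1, -starRingEnd ℂ c] ![c • x, x] ![y, y] (fun T => by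
      simp [mul_comm]) S
    simp at this
    rw [smul_eq_mul]
    linear_combination this
  have smulR : ∀ (c : ℂ) x y, spectralForm N S x (c • y) =
      RingHom.id ℂ c • spectralForm N S x y := fun c x y => by
    have := sum_mul_spectralForm N ![1, -c] ![x, x] ![c • y, y] (fun T => by
      simp) S
    simp at this
    rw [smul_eq_mul, RingHom.id_apply]
    linear_combination this
  have diag : ∀ x, spectralForm N S x x = ((scalarSpectralMeasure N x).real S : ℂ) := fun x => by
    have := sum_mul_scalarSpectralMeasure N ![4, -1, 1, -Complex.I, Complex.I]
      ![x, x + x, x - x, x - Complex.I • x, x + Complex.I • x] (fun T => by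
        simp [Fin.sum_univ_five]
        ring) S
    simp [Fin.sum_univ_five, -sub_self] at this
    rw [spectralForm]
    linear_combination -this / 4
  have bound : ∀ x y, ‖spectralForm N S x y‖ ≤ 2 * ‖x‖ * ‖y‖ := fun x y => by
    rcases eq_or_ne x 0 with rfl | hx
    · have := smulL 0 0 y
      simp at this
      simp [this]
    rcases eq_or_ne y 0 with rfl | hy
    · have := smulR 0 x 0
      simp at this
      simp [this]
    have hx' : ‖x‖ ≠ 0 := norm_ne_zero_iff.2 hx
    have hy' : ‖y‖ ≠ 0 := norm_ne_zero_iff.2 hy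
    have h := norm_spectralForm_le N S (((‖x‖ : ℂ)⁻¹) • x) (((‖y‖ : ℂ)⁻¹) • y)
    rw [smulL, smulR, norm_smul, norm_smul, norm_smul, norm_smul] at h
    simp [hx', hy'] at h
    rw [← mul_assoc, ← mul_inv, inv_mul_le_iff₀ (by positivity)] at h
    linarith
  let B := (LinearMap.mk₂'ₛₗ (starRingEnd ℂ) (RingHom.id ℂ) (spectralForm N S)
    addL smulL addR smulR).mkContinuous₂ 2 bound
  refine ⟨InnerProductSpace.continuousLinearMapOfBilin B, fun x => ?_⟩
  rw [← inner_conj_symm, InnerProductSpace.continuousLinearMapOfBilin_apply]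
  change starRingEnd ℂ (spectralForm N S x x) = _
  rw [diag, Complex.conj_ofReal]

/-- The spectral projection `χ_S(N)` of a normal operator `N` for a Borel set `S ⊆ ℂ`: the bounded
operator with `⟪x, χ_S(N) x⟫ = μ_x(S)` for all `x` (it is unique, by polarization). -/
def spectralProjection (N : H →L[ℂ] H) [IsStarNormal N] (S : Set ℂ) : H →L[ℂ] H :=
  Classical.choose (exists_spectralProjection N (Subtype.val ⁻¹' S))

theorem inner_spectralProjection (N : H →L[ℂ] H) [IsStarNormal N] (S : Set ℂ) (x : H) :
    ⟪x, spectralProjection N S x⟫_ℂ =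
      ((scalarSpectralMeasure N x).real (Subtype.val ⁻¹' S) : ℂ) :=
  Classical.choose_spec (exists_spectralProjection N (Subtype.val ⁻¹' S)) x

end

/-- Arcs (intervals) of the unit circle: images of intervals of the line under `t ↦ exp (i t)`. The
endpoints may or may not belong to the arc. -/
def IsArc (I : Set Circle) : Prop :=
  ∃ s : Set ℝ, s.OrdConnected ∧ I = Circle.exp '' s

end SpectralCalculus

/-! Write `P_S` for the spectral projection of `S`. If `[A, L]` is compact, so is `[A, f(L)]` for
every continuous `f`: modulo the compact operators, the `f` that work form a closed star algebra
containing the coordinate function (`isCompactOperator_commutator_calculus`). For separated `S` and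
`T`, take `f = 1` on `S` and `f = 0` on `T`; then `P_S [A, f(L)] P_T = -P_S A P_T`.

Conversely, cut the circle into `n` equal arcs and expand `[A, L]` into blocks `P_i [A, L] P_j`.
Blocks between non-adjacent arcs are compact by hypothesis, since `P_i [A, L] P_j = [P_i A P_j, L]`.
The others lie on three cyclic diagonals. On such a block `L` is within `O(1/n)` of a scalar, so the
block has norm `O(‖A‖/n)` (`norm_block_commutator_le`). Orthogonality of rows and columns bounds a
whole diagonal by its largest block (`norm_sum_blocks_le`), so no factor `n` appears. Hence `[A, L]`
is a norm limit of compact operators.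

The projections are given only by their quadratic forms `μ_x(S)`, so their algebra has to be derived
first: `commute_spectralProjection`, `spectralProjection_mul` and
`norm_calculus_mul_spectralProjection_le`. -/

namespace SpectralCalculus

variable {H : Type*} [NormedAddCommGroup H] [InnerProductSpace ℂ H] [CompleteSpace H]

/-! ### Continuous functional calculus and scalar spectral measures -/

/-- The continuous functional calculus of a normal operator, as a star homomorphism. -/
noncomputable abbrev calculus (N : H →L[ℂ] H) [hN : IsStarNormal N] :
    C(spectrum ℂ N, ℂ) →⋆ₐ[ℂ] (H →L[ℂ] H) :=
  cfcHom (R := ℂ) hN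

lemma continuous_calculus (N : H →L[ℂ] H) [hN : IsStarNormal N] : Continuous (calculus N) :=
  cfcHom_continuous (R := ℂ) hN

lemma inner_apply_left_of_isSelfAdjoint {T : H →L[ℂ] H} (hT : IsSelfAdjoint T) (x y : H) :
    ⟪T x, y⟫_ℂ = ⟪x, T y⟫_ℂ :=
  ContinuousLinearMap.isSelfAdjoint_iff_isSymmetric.1 hT x y

/-- An operator commuting with a unitary operator commutes with its continuous functional
calculus. -/
lemma commute_calculus_of_commute (L : unitary (H →L[ℂ] H)) {T : H →L[ℂ] H}
    (hT : Commute T (L : H →L[ℂ] H)) (f : C(spectrum ℂ (L : H →L[ℂ] H), ℂ)) :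
    Commute T (calculus (L : H →L[ℂ] H) f) := by
  -- Since `L* = L⁻¹`, commuting with `L` gives commuting with `L*`; the induction below is over
  -- polynomials in `z` and its conjugate (Stone–Weierstrass).
  have hstar : Commute T (star (L : H →L[ℂ] H)) := by
    have h1 : (L : H →L[ℂ] H) * star (L : H →L[ℂ] H) = 1 := Unitary.coe_mul_star_self L
    have h2 : star (L : H →L[ℂ] H) * (L : H →L[ℂ] H) = 1 := Unitary.coe_star_mul_self L
    calc T * star (L : H →L[ℂ] H)
        = star (L : H →L[ℂ] H) * (L : H →L[ℂ] H) * T * star (L : H →L[ℂ] H) := by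
          rw [h2, one_mul]
      _ = star (L : H →L[ℂ] H) * (T * (L : H →L[ℂ] H)) * star (L : H →L[ℂ] H) := by
          rw [hT.eq, mul_assoc (star (L : H →L[ℂ] H))]
      _ = star (L : H →L[ℂ] H) * T := by rw [mul_assoc, mul_assoc, h1, mul_one]
  induction f using ContinuousMap.induction_on_of_compact with
  | const r =>
    rw [show ContinuousMap.const (spectrum ℂ (L : H →L[ℂ] H)) r = algebraMap ℂ _ r from rfl,
      AlgHomClass.commutes]
    exact (Algebra.commutes r T).symm
  | id => rwa [calculus, cfcHom_id]
  | star_id => rwa [map_star, calculus, cfcHom_id]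
  | add f g hf hg => rw [map_add]; exact hf.add_right hg
  | mul f g hf hg => rw [map_mul]; exact hf.mul_right hg
  | frequently f hf =>
    have hc : IsClosed {g | Commute T (calculus (L : H →L[ℂ] H) g)} := by
      have := continuous_calculus (L : H →L[ℂ] H)
      exact isClosed_eq (by fun_prop) (by fun_prop)
    exact hc.mem_of_frequently_of_tendsto hf Filter.tendsto_id

lemma isSelfAdjoint_calculus_toComplexFun (N : H →L[ℂ] H) [IsStarNormal N]
    (f : C(spectrum ℂ N, ℝ)) : IsSelfAdjoint (calculus N (toComplexFun f)) := by
  rw [isSelfAdjoint_iff, ← map_star]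
  congr 1
  ext t
  simp [toComplexFun]

lemma scalarSpectralMeasure_eq_of_forall_integral (N : H →L[ℂ] H) [IsStarNormal N] (x : H)
    (m : Measure (spectrum ℂ N)) [IsFiniteMeasure m]
    (h : ∀ g : C(spectrum ℂ N, ℝ), ((∫ t, g t ∂m : ℝ) : ℂ) =
      ⟪x, calculus N (toComplexFun g) x⟫_ℂ) :
    scalarSpectralMeasure N x = m := by
  refine ext_of_forall_integral_eq_of_IsFiniteMeasure fun f => ?_
  rw [← Complex.ofReal_inj]
  exact (integral_scalarSpectralMeasure N x f.toContinuousMap).trans (h f.toContinuousMap).symm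

lemma scalarSpectralMeasure_unitary_apply (L : unitary (H →L[ℂ] H)) (x : H) :
    scalarSpectralMeasure (L : H →L[ℂ] H) ((L : H →L[ℂ] H) x) =
      scalarSpectralMeasure (L : H →L[ℂ] H) x := by
  refine scalarSpectralMeasure_eq_of_forall_integral _ _ _ fun g => ?_
  have hc := (commute_calculus_of_commute L (Commute.refl _) (toComplexFun g)).eq
  have h2 : star (L : H →L[ℂ] H) * (L : H →L[ℂ] H) = 1 := Unitary.coe_star_mul_self L
  change _ = ⟪_, (calculus (L : H →L[ℂ] H) (toComplexFun g) * (L : H →L[ℂ] H)) x⟫_ℂ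
  rw [integral_scalarSpectralMeasure, ← hc, mul_apply_eq_comp,
    ← ContinuousLinearMap.adjoint_inner_left (L : H →L[ℂ] H),
    ← ContinuousLinearMap.star_eq_adjoint, ← mul_apply_eq_comp (star (L : H →L[ℂ] H)), h2]
  rfl

/-- For real `f`, `⟪f(N)x, g(N) f(N)x⟫ = ⟪x, (f g f)(N) x⟫`. -/
lemma scalarSpectralMeasure_calculus_apply (N : H →L[ℂ] H) [IsStarNormal N]
    (f : C(spectrum ℂ N, ℝ)) (x : H) :
    scalarSpectralMeasure N (calculus N (toComplexFun f) x) =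
      (scalarSpectralMeasure N x).withDensity fun t => ENNReal.ofReal (f t ^ 2) := by
  have : IsFiniteMeasure ((scalarSpectralMeasure N x).withDensity
      fun t => ENNReal.ofReal (f t ^ 2)) := by
    refine isFiniteMeasure_withDensity_ofReal ?_
    exact ((BoundedContinuousFunction.mkOfCompact (f ^ 2)).integrable
      (scalarSpectralMeasure N x)).2
  refine scalarSpectralMeasure_eq_of_forall_integral _ _ _ fun g => ?_
  rw [integral_withDensity_eq_integral_toReal_smul (f := fun t => ENNReal.ofReal (f t ^ 2))
    (ENNReal.continuous_ofReal.comp (by fun_prop)).measurable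
    (Filter.Eventually.of_forall fun _ => ENNReal.ofReal_lt_top)]
  have h := integral_scalarSpectralMeasure N x (f * g * f)
  have e : toComplexFun (f * g * f) = toComplexFun f * toComplexFun g * toComplexFun f := by
    ext t; simp [toComplexFun]
  rw [e, map_mul, map_mul] at h
  rw [inner_apply_left_of_isSelfAdjoint (isSelfAdjoint_calculus_toComplexFun N f)]
  refine Eq.trans ?_ h
  congr 2
  ext t
  rw [ENNReal.toReal_ofReal (sq_nonneg _)]
  simp
  ring

/-! ### Algebra of the spectral projections -/

lemma eq_of_forall_inner_self {E : Type*} [NormedAddCommGroup E] [InnerProductSpace ℂ E]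
    {S T : E →L[ℂ] E} (h : ∀ x, ⟪x, S x⟫_ℂ = ⟪x, T x⟫_ℂ) : S = T := by
  refine ContinuousLinearMap.coe_injective ((ext_inner_map _ _).1 fun x => ?_)
  rw [← inner_conj_symm, ← inner_conj_symm (T.toLinearMap x)]
  exact congrArg _ (h x)

lemma isSelfAdjoint_spectralProjection (N : H →L[ℂ] H) [IsStarNormal N] (S : Set ℂ) :
    IsSelfAdjoint (spectralProjection N S) := by
  refine eq_of_forall_inner_self fun x => ?_
  rw [ContinuousLinearMap.star_eq_adjoint, ContinuousLinearMap.adjoint_inner_right,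
    ← inner_conj_symm, inner_spectralProjection, Complex.conj_ofReal]

/-- `L* P L` and `P` have the same quadratic form because `Lx` and `x` have the same spectral
measure. -/
lemma commute_spectralProjection (L : unitary (H →L[ℂ] H)) (S : Set ℂ) :
    Commute (spectralProjection (L : H →L[ℂ] H) S) (L : H →L[ℂ] H) := by
  have h1 : (L : H →L[ℂ] H) * star (L : H →L[ℂ] H) = 1 := Unitary.coe_mul_star_self L
  have h : star (L : H →L[ℂ] H) * (spectralProjection (L : H →L[ℂ] H) S * (L : H →L[ℂ] H)) =
      spectralProjection (L : H →L[ℂ] H) S := by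
    refine eq_of_forall_inner_self fun x => ?_
    rw [mul_apply_eq_comp, ContinuousLinearMap.star_eq_adjoint,
      ContinuousLinearMap.adjoint_inner_right, mul_apply_eq_comp,
      inner_spectralProjection, inner_spectralProjection, scalarSpectralMeasure_unitary_apply]
  calc _ = (L : H →L[ℂ] H) * star (L : H →L[ℂ] H) *
        (spectralProjection (L : H →L[ℂ] H) S * (L : H →L[ℂ] H)) := by rw [h1, one_mul]
    _ = _ := by rw [mul_assoc, h]

/-- For `g = f²` the left side is `⟪f(L)x, P_S f(L)x⟫`, the mass of `S` under the measure with
density `f²`. General `g` follows as a difference of two squares. -/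
lemma inner_spectralProjection_calculus (L : unitary (H →L[ℂ] H)) {S : Set ℂ} (hS : MeasurableSet S)
    (g : C(spectrum ℂ (L : H →L[ℂ] H), ℝ)) (x : H) :
    ⟪x, spectralProjection (L : H →L[ℂ] H) S
      (calculus (L : H →L[ℂ] H) (toComplexFun g) x)⟫_ℂ =
      ((∫ t in Subtype.val ⁻¹' S, g t ∂(scalarSpectralMeasure (L : H →L[ℂ] H) x) : ℝ) : ℂ) := by
  have hS' : MeasurableSet ((Subtype.val : spectrum ℂ (L : H →L[ℂ] H) → ℂ) ⁻¹' S) :=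
    measurable_subtype_coe hS
  have hint : ∀ f : C(spectrum ℂ (L : H →L[ℂ] H), ℝ), IntegrableOn f (Subtype.val ⁻¹' S)
      (scalarSpectralMeasure (L : H →L[ℂ] H) x) := fun f =>
    ((BoundedContinuousFunction.mkOfCompact f).integrable _).integrableOn
  have sq : ∀ f : C(spectrum ℂ (L : H →L[ℂ] H), ℝ), ⟪x, spectralProjection (L : H →L[ℂ] H) S
      (calculus (L : H →L[ℂ] H) (toComplexFun (f * f)) x)⟫_ℂ =
      ((∫ t in Subtype.val ⁻¹' S, (f * f) t ∂(scalarSpectralMeasure (L : H →L[ℂ] H) x) : ℝ) : ℂ) := by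
    intro f
    have h := inner_spectralProjection (L : H →L[ℂ] H) S
      (calculus (L : H →L[ℂ] H) (toComplexFun f) x)
    rw [scalarSpectralMeasure_calculus_apply,
      inner_apply_left_of_isSelfAdjoint (isSelfAdjoint_calculus_toComplexFun _ f)] at h
    have hcom := commute_calculus_of_commute L (commute_spectralProjection L S) (toComplexFun f)
    have e : toComplexFun (f * f) = toComplexFun f * toComplexFun f := by
      ext t; simp [toComplexFun]
    have e2 : spectralProjection (L : H →L[ℂ] H) S * calculus (L : H →L[ℂ] H) (toComplexFun (f * f)) =
        calculus (L : H →L[ℂ] H) (toComplexFun f) * (spectralProjection (L : H →L[ℂ] H) S *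
          calculus (L : H →L[ℂ] H) (toComplexFun f)) := by
      rw [e, map_mul, ← mul_assoc, hcom.eq, mul_assoc, hcom.eq]
    rw [← mul_apply_eq_comp, e2]
    refine h.trans (congrArg _ ?_)
    have h1 := setIntegral_withDensity_eq_setIntegral_toReal_smul
      (μ := scalarSpectralMeasure (L : H →L[ℂ] H) x) (f := fun t => ENNReal.ofReal (f t ^ 2))
      (ENNReal.continuous_ofReal.comp (by fun_prop)).measurable
      (Filter.Eventually.of_forall fun _ => ENNReal.ofReal_lt_top) (fun _ => (1 : ℝ)) hS'
    rw [setIntegral_const, smul_eq_mul, mul_one] at h1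
    rw [h1]
    congr 1
    ext t
    rw [ENNReal.toReal_ofReal (sq_nonneg _)]
    simp [_root_.sq]
  have hg : g = ((1 / 2 : ℝ) • (g + 1)) * ((1 / 2 : ℝ) • (g + 1)) -
      ((1 / 2 : ℝ) • (g - 1)) * ((1 / 2 : ℝ) • (g - 1)) := by
    ext t
    simp
    ring
  have hsub : ∀ f₁ f₂ : C(spectrum ℂ (L : H →L[ℂ] H), ℝ),
      toComplexFun (f₁ - f₂) = toComplexFun f₁ - toComplexFun f₂ := fun f₁ f₂ => by
    ext t; simp [toComplexFun]
  have hi : ∀ f₁ f₂ : C(spectrum ℂ (L : H →L[ℂ] H), ℝ),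
      ∫ t in Subtype.val ⁻¹' S, (f₁ - f₂) t ∂(scalarSpectralMeasure (L : H →L[ℂ] H) x) =
      ∫ t in Subtype.val ⁻¹' S, f₁ t ∂(scalarSpectralMeasure (L : H →L[ℂ] H) x) -
      ∫ t in Subtype.val ⁻¹' S, f₂ t ∂(scalarSpectralMeasure (L : H →L[ℂ] H) x) := fun f₁ f₂ =>
    integral_sub (hint f₁) (hint f₂)
  rw [hg, hsub, map_sub, sub_apply, map_sub, inner_sub_right, sq, sq, hi,
    Complex.ofReal_sub]

/-- With `z = P_S x`, the identity `⟪z, f(L) y⟫ = ⟪x, P_S f(L) y⟫` for continuous `f` becomes, after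
polarization, a linear relation between four finite measures. Such a relation extends from
continuous functions to sets, and evaluating it on `T` replaces `f(L)` by `P_T`. -/
lemma spectralProjection_mul (L : unitary (H →L[ℂ] H)) {S T : Set ℂ} (hS : MeasurableSet S)
    (hT : MeasurableSet T) :
    spectralProjection (L : H →L[ℂ] H) S * spectralProjection (L : H →L[ℂ] H) T =
      spectralProjection (L : H →L[ℂ] H) (T ∩ S) := by
  have hS' : MeasurableSet ((Subtype.val : spectrum ℂ (L : H →L[ℂ] H) → ℂ) ⁻¹' S) :=
    measurable_subtype_coe hS
  have hT' : MeasurableSet ((Subtype.val : spectrum ℂ (L : H →L[ℂ] H) → ℂ) ⁻¹' T) :=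
    measurable_subtype_coe hT
  have polar : ∀ Q : H →L[ℂ] H, IsSelfAdjoint Q → ∀ u v : H,
      (⟪u + v, Q (u + v)⟫_ℂ).re - (⟪u - v, Q (u - v)⟫_ℂ).re = 4 * (⟪u, Q v⟫_ℂ).re := by
    intro Q hQ u v
    have h : (⟪v, Q u⟫_ℂ).re = (⟪u, Q v⟫_ℂ).re := by
      rw [← inner_apply_left_of_isSelfAdjoint hQ, ← inner_conj_symm, Complex.conj_re]
    simp only [map_add, map_sub, inner_add_left, inner_add_right, inner_sub_left, inner_sub_right,
      Complex.add_re, Complex.sub_re, h]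
    ring
  have key : ∀ x y : H, (⟪spectralProjection (L : H →L[ℂ] H) S x,
      spectralProjection (L : H →L[ℂ] H) T y⟫_ℂ).re =
      (⟪x, spectralProjection (L : H →L[ℂ] H) (T ∩ S) y⟫_ℂ).re := by
    intro x y
    set z := spectralProjection (L : H →L[ℂ] H) S x with hz
    let m : Fin 4 → Measure (spectrum ℂ (L : H →L[ℂ] H)) :=
      ![scalarSpectralMeasure (L : H →L[ℂ] H) (z + y), scalarSpectralMeasure (L : H →L[ℂ] H) (z - y),
        (scalarSpectralMeasure (L : H →L[ℂ] H) (x + y)).restrict (Subtype.val ⁻¹' S),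
        (scalarSpectralMeasure (L : H →L[ℂ] H) (x - y)).restrict (Subtype.val ⁻¹' S)]
    have : ∀ i, IsFiniteMeasure (m i) := by
      intro i
      fin_cases i
      · exact inferInstanceAs (IsFiniteMeasure (scalarSpectralMeasure _ _))
      · exact inferInstanceAs (IsFiniteMeasure (scalarSpectralMeasure _ _))
      · exact inferInstanceAs (IsFiniteMeasure ((scalarSpectralMeasure _ _).restrict _))
      · exact inferInstanceAs (IsFiniteMeasure ((scalarSpectralMeasure _ _).restrict _))
    -- The relation is `μ_{z+y} - μ_{z-y} = (μ_{x+y} - μ_{x-y})` restricted to `S`.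
    have h := sum_mul_measure_real_eq_zero m ![1, -1, -1, 1] (fun f => by
        set F := calculus (L : H →L[ℂ] H)
          (toComplexFun f.toContinuousMap) with hF
        have hsa : IsSelfAdjoint F := isSelfAdjoint_calculus_toComplexFun _ _
        have hcom : Commute (spectralProjection (L : H →L[ℂ] H) S) F :=
          commute_calculus_of_commute L (commute_spectralProjection L S) _
        have hP := isSelfAdjoint_spectralProjection (L : H →L[ℂ] H) S
        have a1 : ∀ w, ∫ t, f t ∂(scalarSpectralMeasure (L : H →L[ℂ] H) w) = (⟪w, F w⟫_ℂ).re :=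
          fun w => by
            rw [hF, ← integral_scalarSpectralMeasure, Complex.ofReal_re]; rfl
        have a2 : ∀ w, ∫ t in Subtype.val ⁻¹' S, f t ∂(scalarSpectralMeasure (L : H →L[ℂ] H) w) =
            (⟪w, (spectralProjection (L : H →L[ℂ] H) S * F) w⟫_ℂ).re := fun w => by
          rw [mul_apply_eq_comp, hF, inner_spectralProjection_calculus L hS,
            Complex.ofReal_re]; rfl
        have p1 := polar F hsa z y
        have p2 := polar _ ((hP.commute_iff hsa).1 hcom) x y
        have p3 : ⟪z, F y⟫_ℂ = ⟪x, (spectralProjection (L : H →L[ℂ] H) S * F) y⟫_ℂ := by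
          rw [hz]; exact inner_apply_left_of_isSelfAdjoint hP _ _
        simp only [m, Fin.sum_univ_four, Matrix.cons_val]
        rw [a1, a1, a2, a2]
        rw [p3] at p1
        linarith) (Subtype.val ⁻¹' T)
    simp only [m, Fin.sum_univ_four, Matrix.cons_val] at h
    rw [measureReal_restrict_apply hT', measureReal_restrict_apply hT', ← Set.preimage_inter] at h
    have b : ∀ (R : Set ℂ) w, (scalarSpectralMeasure (L : H →L[ℂ] H) w).real (Subtype.val ⁻¹' R) =
        (⟪w, spectralProjection (L : H →L[ℂ] H) R w⟫_ℂ).re := fun R w => by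
      rw [inner_spectralProjection, Complex.ofReal_re]
    rw [b, b, b, b] at h
    have p1 := polar _ (isSelfAdjoint_spectralProjection (L : H →L[ℂ] H) T) z y
    have p2 := polar _ (isSelfAdjoint_spectralProjection (L : H →L[ℂ] H) (T ∩ S)) x y
    linarith
  ext y
  refine ext_inner_left ℂ fun x => ?_
  rw [mul_apply_eq_comp,
    ← inner_apply_left_of_isSelfAdjoint (isSelfAdjoint_spectralProjection (L : H →L[ℂ] H) S)]
  apply Complex.ext
  · exact key x y
  -- Replacing `x` by `i x` turns the real part into the imaginary part.
  · have := key (Complex.I • x) y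
    simpa using this

lemma spectralProjection_mul_self (L : unitary (H →L[ℂ] H)) {S : Set ℂ} (hS : MeasurableSet S) :
    spectralProjection (L : H →L[ℂ] H) S * spectralProjection (L : H →L[ℂ] H) S =
      spectralProjection (L : H →L[ℂ] H) S := by
  rw [spectralProjection_mul L hS hS, Set.inter_self]

lemma norm_spectralProjection_apply_sq (L : unitary (H →L[ℂ] H)) {S : Set ℂ}
    (hS : MeasurableSet S) (x : H) :
    ‖spectralProjection (L : H →L[ℂ] H) S x‖ ^ 2 =
      (scalarSpectralMeasure (L : H →L[ℂ] H) x).real (Subtype.val ⁻¹' S) := by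
  have h := inner_spectralProjection (L : H →L[ℂ] H) S x
  rw [← spectralProjection_mul_self L hS, mul_apply_eq_comp] at h
  rw [← inner_apply_left_of_isSelfAdjoint (isSelfAdjoint_spectralProjection (L : H →L[ℂ] H) S),
    inner_self_eq_norm_sq_to_K] at h
  rw [← Complex.ofReal_inj, ← h]
  simp

lemma norm_spectralProjection_le_one (L : unitary (H →L[ℂ] H)) {S : Set ℂ}
    (hS : MeasurableSet S) : ‖spectralProjection (L : H →L[ℂ] H) S‖ ≤ 1 := by
  refine ContinuousLinearMap.opNorm_le_bound _ zero_le_one fun x => ?_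
  rw [one_mul]
  refine (sq_le_sq₀ (norm_nonneg _) (norm_nonneg _)).1 ?_
  rw [norm_spectralProjection_apply_sq L hS, ← scalarSpectralMeasure_real_univ (L : H →L[ℂ] H) x]
  exact measureReal_mono (Set.subset_univ _)

/-- If `|f| ≤ c` on `S`, then `f(L)` is bounded by `c` on the range of the spectral projection
`χ_S(L)`. -/
lemma norm_calculus_mul_spectralProjection_le (L : unitary (H →L[ℂ] H)) {S : Set ℂ}
    (hS : MeasurableSet S) (f : C(spectrum ℂ (L : H →L[ℂ] H), ℂ)) {c : ℝ} (hc : 0 ≤ c)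
    (hf : ∀ t : spectrum ℂ (L : H →L[ℂ] H), (t : ℂ) ∈ S → ‖f t‖ ≤ c) :
    ‖calculus (L : H →L[ℂ] H) f *
      spectralProjection (L : H →L[ℂ] H) S‖ ≤ c := by
  have hS' : MeasurableSet ((Subtype.val : spectrum ℂ (L : H →L[ℂ] H) → ℂ) ⁻¹' S) :=
    measurable_subtype_coe hS
  refine ContinuousLinearMap.opNorm_le_bound _ hc fun x => ?_
  refine (sq_le_sq₀ (norm_nonneg _) (by positivity)).1 ?_
  set P := spectralProjection (L : H →L[ℂ] H) S with hP
  set F := calculus (L : H →L[ℂ] H) f with hF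
  let g : C(spectrum ℂ (L : H →L[ℂ] H), ℝ) := ⟨fun t => ‖f t‖ ^ 2, by fun_prop⟩
  have hg : star f * f = toComplexFun g := by
    ext t
    simp [toComplexFun, g, ← Complex.normSq_eq_norm_sq, Complex.normSq_eq_conj_mul_self]
  have hP2 : P * P = P := spectralProjection_mul_self L hS
  have hPs : IsSelfAdjoint P := isSelfAdjoint_spectralProjection _ S
  have e1 : star (F * P) * (F * P) = P * calculus (L : H →L[ℂ] H) (toComplexFun g) := by
    have hcg : Commute P (star F * F) := by
      rw [hF, ← map_star, ← map_mul]
      exact commute_calculus_of_commute L (commute_spectralProjection L S) _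
    rw [← hg, map_mul, map_star, star_mul, hPs.star_eq, ← hF, mul_assoc, ← mul_assoc (star F),
      ← hcg.eq, ← mul_assoc, hP2]
  -- By `e1` this is `⟪x, P_S |f|²(L) x⟫`, an integral over `S`, where `|f|² ≤ c²`.
  have h1 : ‖(F * P) x‖ ^ 2 =
      ∫ t in Subtype.val ⁻¹' S, g t ∂(scalarSpectralMeasure (L : H →L[ℂ] H) x) := by
    rw [← Complex.ofReal_inj, ← inner_spectralProjection_calculus L hS, ← mul_apply_eq_comp P, ← e1,
      mul_apply_eq_comp (star (F * P)), ContinuousLinearMap.star_eq_adjoint,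
      ContinuousLinearMap.adjoint_inner_right, inner_self_eq_norm_sq_to_K]
    simp
  rw [h1, mul_pow, ← scalarSpectralMeasure_real_univ (L : H →L[ℂ] H) x]
  refine (setIntegral_mono_on (g := fun _ => c ^ 2)
    ((BoundedContinuousFunction.mkOfCompact g).integrable _).integrableOn
    (integrable_const _).integrableOn hS' fun t ht => ?_).trans ?_
  · exact pow_le_pow_left₀ (norm_nonneg _) (hf t ht) 2
  · rw [setIntegral_const, smul_eq_mul, mul_comm]
    exact mul_le_mul_of_nonneg_left (measureReal_mono (Set.subset_univ _)) (sq_nonneg c)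

/-! ### Commutators modulo the compact operators -/

variable {E : Type*} [NormedAddCommGroup E] [NormedSpace ℂ E]

lemma isCompactOperator_mul_left {K : E →L[ℂ] E} (hK : IsCompactOperator K) (B : E →L[ℂ] E) :
    IsCompactOperator (B * K) :=
  hK.clm_comp B

lemma isCompactOperator_mul_right {K : E →L[ℂ] E} (hK : IsCompactOperator K) (B : E →L[ℂ] E) :
    IsCompactOperator (K * B) :=
  hK.comp_clm B

lemma isCompactOperator_add {K K' : E →L[ℂ] E} (hK : IsCompactOperator K)
    (hK' : IsCompactOperator K') : IsCompactOperator (K + K') :=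
  hK.add hK'

lemma isCompactOperator_sub {K K' : E →L[ℂ] E} (hK : IsCompactOperator K)
    (hK' : IsCompactOperator K') : IsCompactOperator (K - K') :=
  hK.sub hK'

lemma isCompactOperator_sum {ι : Type*} (s : Finset ι) {K : ι → E →L[ℂ] E}
    (hK : ∀ i ∈ s, IsCompactOperator (K i)) : IsCompactOperator (∑ i ∈ s, K i : E →L[ℂ] E) :=
  (compactOperator (RingHom.id ℂ) E E).sum_mem hK

lemma isClosed_isCompactOperator : IsClosed {K : H →L[ℂ] H | IsCompactOperator K} :=
  isClosed_setOfPred_isCompactOperator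

/-- An operator commuting with a unitary operator modulo the compact operators commutes with its
continuous functional calculus modulo the compact operators. -/
lemma isCompactOperator_commutator_calculus (L : unitary (H →L[ℂ] H)) {A : H →L[ℂ] H}
    (hA : IsCompactOperator (A * (L : H →L[ℂ] H) - (L : H →L[ℂ] H) * A))
    (f : C(spectrum ℂ (L : H →L[ℂ] H), ℂ)) :
    IsCompactOperator (A * calculus (L : H →L[ℂ] H) f - calculus (L : H →L[ℂ] H) f * A) := by
  induction f using ContinuousMap.induction_on_of_compact with
  | const r =>
    rw [show ContinuousMap.const (spectrum ℂ (L : H →L[ℂ] H)) r = algebraMap ℂ _ r from rfl,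
      AlgHomClass.commutes, Algebra.commutes r A, sub_self]
    exact isCompactOperator_zero
  | id => rwa [calculus, cfcHom_id]
  | star_id =>
    rw [map_star, calculus, cfcHom_id]
    have h1 : (L : H →L[ℂ] H) * star (L : H →L[ℂ] H) = 1 := Unitary.coe_mul_star_self L
    have h2 : star (L : H →L[ℂ] H) * (L : H →L[ℂ] H) = 1 := Unitary.coe_star_mul_self L
    -- For unitary `L`, `[A, L*] = -L* [A, L] L*`.
    have h : A * star (L : H →L[ℂ] H) - star (L : H →L[ℂ] H) * A = (0 - star (L : H →L[ℂ] H)) *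
        ((A * (L : H →L[ℂ] H) - (L : H →L[ℂ] H) * A) * star (L : H →L[ℂ] H)) := by
      have e1 : star (L : H →L[ℂ] H) * (A * (L : H →L[ℂ] H) * star (L : H →L[ℂ] H)) =
          star (L : H →L[ℂ] H) * A := by rw [mul_assoc A, h1, mul_one]
      have e2 : star (L : H →L[ℂ] H) * ((L : H →L[ℂ] H) * A * star (L : H →L[ℂ] H)) =
          A * star (L : H →L[ℂ] H) := by rw [mul_assoc, ← mul_assoc, h2, one_mul]
      rw [zero_sub, neg_mul, sub_mul, mul_sub, e1, e2, neg_sub]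
    rw [h]
    exact isCompactOperator_mul_left (isCompactOperator_mul_right hA _) _
  | add f g hf hg =>
    rw [map_add, mul_add, add_mul, add_sub_add_comm]
    exact isCompactOperator_add hf hg
  | mul f g hf hg =>
    rw [map_mul]
    -- Leibniz rule: `[A, fg] = [A, f] g + f [A, g]`.
    have h := isCompactOperator_add
      (isCompactOperator_mul_right hf (calculus (L : H →L[ℂ] H) g))
      (isCompactOperator_mul_left hg (calculus (L : H →L[ℂ] H) f))
    convert h using 2
    noncomm_ring
  | frequently f hf =>
    have hc : IsClosed {g | IsCompactOperator
        (A * calculus (L : H →L[ℂ] H) g - calculus (L : H →L[ℂ] H) g * A)} := by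
      have := continuous_calculus (L : H →L[ℂ] H)
      exact isClosed_isCompactOperator.preimage
        (f := fun g => A * calculus (L : H →L[ℂ] H) g - calculus (L : H →L[ℂ] H) g * A)
        (by fun_prop)
    exact hc.mem_of_frequently_of_tendsto hf Filter.tendsto_id

/-! ### From compact commutator to compact blocks -/

/-- The exponential is injective on each half-open period, so the Lusin–Souslin theorem makes the
image of each piece Borel; countably many pieces cover the arc. -/
lemma measurableSet_coe_image_of_isArc {I : Set Circle} (hI : IsArc I) :
    MeasurableSet ((↑) '' I : Set ℂ) := by
  obtain ⟨s, hs, rfl⟩ := hI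
  have e : ((↑) '' (Circle.exp '' s) : Set ℂ) = ⋃ n : ℤ, (fun t : ℝ => (Circle.exp t : ℂ)) ''
      (s ∩ Set.Ico (0 + n • (2 * Real.pi)) (0 + (n + 1) • (2 * Real.pi))) := by
    rw [← Set.image_iUnion, ← Set.inter_iUnion, iUnion_Ico_add_zsmul Real.two_pi_pos,
      Set.inter_univ]
    exact Set.image_image _ _ _
  rw [e]
  refine MeasurableSet.iUnion fun n => ?_
  refine (hs.measurableSet.inter measurableSet_Ico).image_of_continuousOn_injOn
    (by fun_prop) fun x hx y hy h => ?_
  obtain ⟨m, hm⟩ := Circle.exp_eq_exp.1 (Subtype.coe_injective h)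
  have hx' := hx.2
  have hy' := hy.2
  simp only [zsmul_eq_mul, zero_add, Set.mem_Ico, Int.cast_add, Int.cast_one] at hx' hy'
  have hpi := Real.pi_pos
  have h1 : (m : ℝ) < 1 := by
    by_contra hc
    nlinarith
  have h2 : (-1 : ℝ) < m := by
    by_contra hc
    nlinarith
  have h3 : m < 1 := by exact_mod_cast h1
  have h4 : -1 < m := by exact_mod_cast h2
  have : m = 0 := by omega
  simpa [this] using hm

/-- If `A` commutes with `L` modulo the compact operators, then it has compact blocks between
separated spectral subspaces of `L`. -/
lemma isCompactOperator_block_of_commutator (L : unitary (H →L[ℂ] H)) {A : H →L[ℂ] H}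
    (hA : IsCompactOperator (A * (L : H →L[ℂ] H) - (L : H →L[ℂ] H) * A)) {S T : Set ℂ}
    (hS : MeasurableSet S) (hT : MeasurableSet T) {r : ℝ} (hr : 0 < r)
    (hST : ∀ x ∈ S, ∀ y ∈ T, r ≤ dist x y) :
    IsCompactOperator (spectralProjection (L : H →L[ℂ] H) S * A *
      spectralProjection (L : H →L[ℂ] H) T) := by
  -- A continuous cutoff: `1` on `S`, and `0` off the `r`-thickening of `S`, which misses `T`.
  let f : C(spectrum ℂ (L : H →L[ℂ] H), ℂ) :=
    ⟨fun t => ((thickenedIndicator hr S (t : ℂ) : ℝ) : ℂ), by fun_prop⟩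
  have hfS : ∀ t : spectrum ℂ (L : H →L[ℂ] H), (t : ℂ) ∈ S → f t = 1 := fun t ht => by
    change ((thickenedIndicator hr S (t : ℂ) : ℝ) : ℂ) = 1
    rw [thickenedIndicator_one hr S ht]
    simp
  have hfT : ∀ t : spectrum ℂ (L : H →L[ℂ] H), (t : ℂ) ∈ T → f t = 0 := fun t ht => by
    have : (t : ℂ) ∉ Metric.thickening r S := fun h => by
      obtain ⟨z, hz, hd⟩ := Metric.mem_thickening_iff.1 h
      exact absurd (hST z hz t ht) (not_le.2 (by rwa [dist_comm]))
    change ((thickenedIndicator hr S (t : ℂ) : ℝ) : ℂ) = 0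
    rw [thickenedIndicator_zero hr S this]
    simp
  have h1 : calculus (L : H →L[ℂ] H) f * spectralProjection (L : H →L[ℂ] H) T = 0 := by
    rw [← norm_le_zero_iff]
    exact norm_calculus_mul_spectralProjection_le L hT f le_rfl fun t ht => by simp [hfT t ht]
  have h2 : spectralProjection (L : H →L[ℂ] H) S * calculus (L : H →L[ℂ] H) f =
      spectralProjection (L : H →L[ℂ] H) S := by
    have h := norm_calculus_mul_spectralProjection_le L hS (f - 1) le_rfl fun t ht => by
      simp [hfS t ht]
    rw [norm_le_zero_iff, map_sub, map_one, sub_mul, one_mul, sub_eq_zero] at h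
    rw [(commute_calculus_of_commute L (commute_spectralProjection L S) f).eq, h]
  have h := isCompactOperator_mul_right (isCompactOperator_mul_left
    (isCompactOperator_commutator_calculus L hA f) (spectralProjection (L : H →L[ℂ] H) S))
    (spectralProjection (L : H →L[ℂ] H) T)
  have e : spectralProjection (L : H →L[ℂ] H) S *
      (A * calculus (L : H →L[ℂ] H) f - calculus (L : H →L[ℂ] H) f * A) *
      spectralProjection (L : H →L[ℂ] H) T =
      -(spectralProjection (L : H →L[ℂ] H) S * A * spectralProjection (L : H →L[ℂ] H) T) := by
    rw [mul_sub, sub_mul, ← mul_assoc, mul_assoc _ (calculus (L : H →L[ℂ] H) f), h1, mul_zero,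
      ← mul_assoc, h2, zero_sub]
  rw [e] at h
  simpa using isCompactOperator_mul_left h (-1)

/-! ### Partition of the circle into equal arcs -/

lemma exists_pos_le_dist_of_iInf_edist_pos {X : Type*} [PseudoMetricSpace X] {I J : Set X}
    (h : 0 < ⨅ x ∈ I, ⨅ y ∈ J, edist x y) : ∃ r : ℝ, 0 < r ∧ ∀ x ∈ I, ∀ y ∈ J, r ≤ dist x y := by
  obtain ⟨r, hr, hrl⟩ := ENNReal.lt_iff_exists_real_btwn.1 h
  refine ⟨r, ENNReal.ofReal_pos.1 hrl.1, fun x hx y hy => ?_⟩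
  have : ENNReal.ofReal r ≤ edist x y :=
    hrl.2.le.trans ((iInf₂_le x hx).trans (iInf₂_le y hy))
  rw [edist_dist] at this
  exact (ENNReal.ofReal_le_ofReal_iff dist_nonneg).1 this

/-- The `i`-th of the `n` half-open arcs of equal length that partition the circle. -/
def equalArc (n : ℕ) [NeZero n] (i : ZMod n) : Set Circle :=
  (fun s => ZMod.toCircle i * Circle.exp s) '' Set.Ico 0 (2 * Real.pi / n)

lemma toCircle_intCast_eq_exp (n : ℕ) [NeZero n] (j : ℤ) :
    ZMod.toCircle (j : ZMod n) = Circle.exp (j * (2 * Real.pi / n)) := by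
  apply Subtype.ext
  rw [ZMod.toCircle_intCast, Circle.coe_exp]
  congr 1
  push_cast
  ring

lemma isArc_equalArc (n : ℕ) [NeZero n] (i : ZMod n) : IsArc (equalArc n i) := by
  obtain ⟨j, rfl⟩ := ZMod.intCast_surjective i
  refine ⟨(fun s => j * (2 * Real.pi / n) + s) '' Set.Ico 0 (2 * Real.pi / n), ?_, ?_⟩
  · rw [Set.image_const_add_Ico]
    exact Set.ordConnected_Ico
  · rw [Set.image_image, equalArc, toCircle_intCast_eq_exp]
    simp only [Circle.exp_add]

lemma exists_mem_equalArc (n : ℕ) [NeZero n] (z : Circle) : ∃ i, z ∈ equalArc n i := by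
  have hn : (0 : ℝ) < n := by exact_mod_cast NeZero.pos n
  have hδ : 0 < 2 * Real.pi / n := by positivity
  obtain ⟨θ, rfl⟩ : ∃ θ, Circle.exp θ = z := ⟨_, Circle.exp_arg z⟩
  obtain ⟨j, hj, -⟩ := existsUnique_sub_zsmul_mem_Ico hδ θ 0
  refine ⟨j, _, ⟨hj.1, by simpa using hj.2⟩, ?_⟩
  rw [toCircle_intCast_eq_exp]
  simp

/-- Points of two translates of an interval coincide on the circle only if the translations differ
by the difference of the arguments. -/
lemma exists_int_of_toCircle_mul_exp_eq {n : ℕ} [NeZero n] {i k : ZMod n} {s t : ℝ}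
    (h : ZMod.toCircle i * Circle.exp s = ZMod.toCircle (i + k) * Circle.exp t) :
    ∃ l : ℤ, k = l ∧ s - t = l * (2 * Real.pi / n) := by
  have hn : (n : ℝ) ≠ 0 := by exact_mod_cast NeZero.ne n
  rw [AddChar.map_add_eq_mul, mul_assoc, mul_right_inj] at h
  obtain ⟨j, rfl⟩ := ZMod.intCast_surjective k
  rw [toCircle_intCast_eq_exp, ← Circle.exp_add, Circle.exp_eq_exp] at h
  obtain ⟨m, hm⟩ := h
  refine ⟨j + m * n, by simp, ?_⟩
  rw [hm]
  push_cast
  field_simp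
  ring

lemma pairwise_disjoint_equalArc (n : ℕ) [NeZero n] : Pairwise (Function.onFun Disjoint (equalArc n)) := by
  intro i j hij
  rw [Function.onFun, Set.disjoint_left]
  rintro z ⟨s, hs, rfl⟩ ⟨t, ht, h⟩
  have hn : (0 : ℝ) < n := by exact_mod_cast NeZero.pos n
  have hδ : 0 < 2 * Real.pi / n := by positivity
  obtain ⟨l, hl, hst⟩ := exists_int_of_toCircle_mul_exp_eq (i := i) (k := j - i) (s := s) (t := t)
    (by rw [add_sub_cancel]; exact h.symm)
  have h1 : (l : ℝ) < 1 := by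
    by_contra hc
    nlinarith [hs.1, hs.2, ht.1, ht.2]
  have h2 : (-1 : ℝ) < l := by
    by_contra hc
    nlinarith [hs.1, hs.2, ht.1, ht.2]
  have h3 : l < 1 := by exact_mod_cast h1
  have h4 : -1 < l := by exact_mod_cast h2
  obtain rfl : l = 0 := by omega
  rw [Int.cast_zero, sub_eq_zero] at hl
  exact hij hl.symm

/-- The closed arcs are compact, and two of them can meet only if their indices differ by `0`, `1`
or `-1`: the arguments differ by at most one arc length. Disjoint compact sets have positive
distance. -/
lemma iInf_edist_equalArc_pos {n : ℕ} [NeZero n] (i : ZMod n) {k : ZMod n}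
    (h0 : k ≠ 0) (h1 : k ≠ 1) (h2 : k ≠ -1) :
    0 < ⨅ x ∈ equalArc n i, ⨅ y ∈ equalArc n (i + k), edist x y := by
  let C : ZMod n → Set Circle := fun i =>
    (fun s => ZMod.toCircle i * Circle.exp s) '' Set.Icc 0 (2 * Real.pi / n)
  have hC : ∀ i, IsCompact (C i) := fun i => isCompact_Icc.image (by fun_prop)
  have hsub : ∀ i, equalArc n i ⊆ C i := fun i => Set.image_mono Set.Ico_subset_Icc_self
  have hd : Disjoint (C i) (C (i + k)) := by
    rw [Set.disjoint_left]
    rintro z ⟨s, hs, rfl⟩ ⟨t, ht, h⟩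
    have hn : (0 : ℝ) < n := by exact_mod_cast NeZero.pos n
    have hδ : 0 < 2 * Real.pi / n := by positivity
    obtain ⟨l, hl, hst⟩ := exists_int_of_toCircle_mul_exp_eq h.symm
    have h3 : (l : ℝ) < 2 := by
      by_contra hc
      nlinarith [hs.1, hs.2, ht.1, ht.2]
    have h4 : (-2 : ℝ) < l := by
      by_contra hc
      nlinarith [hs.1, hs.2, ht.1, ht.2]
    have h5 : l < 2 := by exact_mod_cast h3
    have h6 : -2 < l := by exact_mod_cast h4
    have : l = 0 ∨ l = 1 ∨ l = -1 := by omega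
    rcases this with rfl | rfl | rfl
    · exact h0 (by simpa using hl)
    · exact h1 (by simpa using hl)
    · exact h2 (by simpa using hl)
  obtain ⟨r, hr, hrd⟩ := hd.exists_thickenings (hC i) (hC (i + k)).isClosed
  refine lt_of_lt_of_le (ENNReal.ofReal_pos.2 hr) (le_iInf₂ fun x hx => le_iInf₂ fun y hy => ?_)
  rw [edist_dist]
  refine ENNReal.ofReal_le_ofReal (not_lt.1 fun hlt => ?_)
  refine Set.disjoint_left.1 hrd (Metric.mem_thickening_iff.2 ⟨x, hsub _ hx, ?_⟩)
    (Metric.self_subset_thickening hr _ (hsub _ hy))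
  rwa [dist_comm]

/-- The reference point is the initial endpoint of arc `i`. Arc `i` and its neighbours lie within
two arc lengths `2π/n` of it, and a chord is no longer than its angle. -/
lemma norm_sub_toCircle_le {n : ℕ} [NeZero n] {i k : ZMod n} (hk : k = 0 ∨ k = 1 ∨ k = -1)
    {z : Circle} (hz : z ∈ equalArc n (i + k)) :
    ‖(z : ℂ) - ZMod.toCircle i‖ ≤ 4 * Real.pi / n := by
  have hn : (0 : ℝ) < n := by exact_mod_cast NeZero.pos n
  have hδ : 0 < 2 * Real.pi / n := by positivity
  obtain ⟨s, hs, rfl⟩ := hz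
  obtain ⟨l, rfl, hl⟩ : ∃ l : ℤ, k = l ∧ |(l : ℝ)| ≤ 1 := by
    rcases hk with rfl | rfl | rfl
    · exact ⟨0, by simp⟩
    · exact ⟨1, by simp⟩
    · exact ⟨-1, by simp⟩
  change ‖((ZMod.toCircle (i + (l : ZMod n)) * Circle.exp s : Circle) : ℂ) - _‖ ≤ _
  rw [AddChar.map_add_eq_mul, toCircle_intCast_eq_exp, mul_assoc, ← Circle.exp_add]
  rw [Circle.coe_mul, ← mul_sub_one, norm_mul, Circle.norm_coe, one_mul, Circle.coe_exp]
  rw [mul_comm _ Complex.I]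
  refine (Real.norm_exp_I_mul_ofReal_sub_one_le).trans ?_
  rw [Real.norm_eq_abs]
  refine (abs_add_le _ _).trans ?_
  rw [abs_mul, abs_of_pos hδ, abs_of_nonneg hs.1]
  have : 4 * Real.pi / n = 2 * Real.pi / n + 2 * Real.pi / n := by ring
  rw [this]
  exact add_le_add (mul_le_of_le_one_left hδ.le hl) hs.2.le

/-! ### Orthogonal decompositions and block sums -/

section Partition

variable {ι : Type*} [Fintype ι] (L : unitary (H →L[ℂ] H)) (S : ι → Set ℂ)

lemma sum_norm_spectralProjection_apply_sq (hS : ∀ i, MeasurableSet (S i))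
    (hd : Pairwise (Function.onFun Disjoint S))
    (hc : spectrum ℂ (L : H →L[ℂ] H) ⊆ ⋃ i, S i) (x : H) :
    ∑ i, ‖spectralProjection (L : H →L[ℂ] H) (S i) x‖ ^ 2 = ‖x‖ ^ 2 := by
  simp_rw [fun i => norm_spectralProjection_apply_sq L (hS i) x]
  rw [← scalarSpectralMeasure_real_univ (L : H →L[ℂ] H) x, ← measureReal_biUnion_finset
    (fun i _ j _ hij => (hd hij).preimage _) (fun i _ => measurable_subtype_coe (hS i))]
  congr 1
  ext t
  simpa using hc t.2

lemma sum_spectralProjection_eq_one (hS : ∀ i, MeasurableSet (S i))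
    (hd : Pairwise (Function.onFun Disjoint S))
    (hc : spectrum ℂ (L : H →L[ℂ] H) ⊆ ⋃ i, S i) :
    ∑ i, spectralProjection (L : H →L[ℂ] H) (S i) = 1 := by
  refine eq_of_forall_inner_self fun x => ?_
  rw [sum_apply, inner_sum]
  simp_rw [inner_spectralProjection, fun i => (norm_spectralProjection_apply_sq L (hS i) x).symm]
  rw [← Complex.ofReal_sum, sum_norm_spectralProjection_apply_sq L S hS hd hc x]
  simp [inner_self_eq_norm_sq_to_K]

lemma spectralProjection_empty : spectralProjection (L : H →L[ℂ] H) ∅ = 0 := by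
  refine eq_of_forall_inner_self fun x => ?_
  rw [inner_spectralProjection]
  simp

/-- A sum of blocks whose rows and columns are pairwise distinct is bounded by the largest block. -/
lemma norm_sum_blocks_le (hS : ∀ i, MeasurableSet (S i))
    (hd : Pairwise (Function.onFun Disjoint S))
    (hc : spectrum ℂ (L : H →L[ℂ] H) ⊆ ⋃ i, S i) (σ : Equiv.Perm ι) (T : H →L[ℂ] H) {c : ℝ}
    (hc0 : 0 ≤ c) (hT : ∀ i, ‖spectralProjection (L : H →L[ℂ] H) (S i) * T *
      spectralProjection (L : H →L[ℂ] H) (S (σ i))‖ ≤ c) :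
    ‖∑ i, spectralProjection (L : H →L[ℂ] H) (S i) * T *
      spectralProjection (L : H →L[ℂ] H) (S (σ i))‖ ≤ c := by
  classical
  set P := fun i => spectralProjection (L : H →L[ℂ] H) (S i) with hP
  refine ContinuousLinearMap.opNorm_le_bound _ hc0 fun x => ?_
  refine (sq_le_sq₀ (norm_nonneg _) (by positivity)).1 ?_
  rw [← sum_norm_spectralProjection_apply_sq L S hS hd hc]
  have hPP : ∀ i j, P j * P i = if i = j then P i else 0 := fun i j => by
    split_ifs with h
    · rw [h]; exact spectralProjection_mul_self L (hS j)
    · change spectralProjection _ _ * spectralProjection _ _ = _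
      rw [spectralProjection_mul L (hS j) (hS i), (hd h).inter_eq, spectralProjection_empty]
  have h1 : ∀ j, P j * ∑ i, P i * T * P (σ i) = P j * T * P (σ j) := fun j => by
    rw [Finset.mul_sum, Finset.sum_eq_single j]
    · rw [← mul_assoc, ← mul_assoc, hPP, if_pos rfl]
    · intro i _ hij
      rw [← mul_assoc, ← mul_assoc, hPP, if_neg hij, zero_mul, zero_mul]
    · simp
  -- The component in row `j` sees only the component of `x` in column `σ j`; as `σ` is a
  -- permutation, the squares on the right add up to `c² ‖x‖²`.
  have h2 : ∀ j, ‖P j ((∑ i, P i * T * P (σ i)) x)‖ ^ 2 ≤ c ^ 2 * ‖P (σ j) x‖ ^ 2 := fun j => by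
    have e : P j ((∑ i, P i * T * P (σ i)) x) = (P j * T * P (σ j)) (P (σ j) x) := by
      rw [← mul_apply_eq_comp, h1, ← mul_apply_eq_comp, mul_assoc _ (P (σ j)), hPP, if_pos rfl]
    rw [e, ← mul_pow]
    exact pow_le_pow_left₀ (norm_nonneg _) (ContinuousLinearMap.le_of_opNorm_le _ (hT j) _) 2
  refine (Finset.sum_le_sum fun j _ => h2 j).trans ?_
  rw [← Finset.mul_sum, Equiv.sum_comp σ fun j => ‖P j x‖ ^ 2,
    sum_norm_spectralProjection_apply_sq L S hS hd hc, mul_pow]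

end Partition

/-! ### Approximation of the commutator by compact operators -/

/-- If `S` and `T` lie near a point, the block of the commutator `[A, L]` between them is small. -/
lemma norm_block_commutator_le (L : unitary (H →L[ℂ] H)) (A : H →L[ℂ] H) {S T : Set ℂ}
    (hS : MeasurableSet S) (hT : MeasurableSet T) (a : ℂ) {c : ℝ} (hc : 0 ≤ c)
    (haS : ∀ z ∈ S, ‖z - a‖ ≤ c) (haT : ∀ z ∈ T, ‖z - a‖ ≤ c) :
    ‖spectralProjection (L : H →L[ℂ] H) S * (A * (L : H →L[ℂ] H) - (L : H →L[ℂ] H) * A) *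
      spectralProjection (L : H →L[ℂ] H) T‖ ≤ 2 * (‖A‖ * c) := by
  let f : C(spectrum ℂ (L : H →L[ℂ] H), ℂ) :=
    ContinuousMap.restrict (spectrum ℂ (L : H →L[ℂ] H)) (ContinuousMap.id ℂ) - algebraMap ℂ _ a
  have hf : calculus (L : H →L[ℂ] H) f = (L : H →L[ℂ] H) - algebraMap ℂ _ a := by
    rw [map_sub, AlgHomClass.commutes, calculus, cfcHom_id]
  have key : ∀ {R : Set ℂ}, MeasurableSet R → (∀ z ∈ R, ‖z - a‖ ≤ c) →
      ‖calculus (L : H →L[ℂ] H) f * spectralProjection (L : H →L[ℂ] H) R‖ ≤ c := fun hR h =>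
    norm_calculus_mul_spectralProjection_le L hR f hc fun t ht => h t ht
  set P := spectralProjection (L : H →L[ℂ] H) S
  set Q := spectralProjection (L : H →L[ℂ] H) T
  have hcom : Commute P (calculus (L : H →L[ℂ] H) f) :=
    commute_calculus_of_commute L (commute_spectralProjection L S) f
  -- Scalars drop out of a commutator: `[A, L] = [A, L - a]`, and `f(L) = L - a` is small next to
  -- either projection.
  have e : P * (A * (L : H →L[ℂ] H) - (L : H →L[ℂ] H) * A) * Q =
      P * (A * (calculus (L : H →L[ℂ] H) f * Q)) - calculus (L : H →L[ℂ] H) f * P * (A * Q) := by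
    rw [← hcom.eq, hf]
    have ha : algebraMap ℂ (H →L[ℂ] H) a * A = A * algebraMap ℂ (H →L[ℂ] H) a :=
      Algebra.commutes a A
    simp only [mul_sub, sub_mul, mul_assoc]
    rw [← mul_assoc (algebraMap ℂ (H →L[ℂ] H) a) A Q, ha, mul_assoc]
    abel
  rw [e, two_mul]
  refine (norm_sub_le _ _).trans (add_le_add ?_ ?_)
  · refine (norm_mul_le _ _).trans ((mul_le_of_le_one_left (norm_nonneg _)
      (norm_spectralProjection_le_one L hS)).trans ((norm_mul_le _ _).trans ?_))
    gcongr
    exact key hT haT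
  · rw [mul_comm ‖A‖]
    refine (norm_mul_le _ _).trans (mul_le_mul (key hS haS) ?_ (norm_nonneg _) hc)
    exact (norm_mul_le _ _).trans
      (mul_le_of_le_one_right (norm_nonneg _) (norm_spectralProjection_le_one L hT))

/-- If the blocks of `A` between separated arcs are compact, the commutator `[A, L]` is within
`24 π ‖A‖ / n` of a compact operator. -/
lemma exists_isCompactOperator_norm_commutator_sub_le (L : unitary (H →L[ℂ] H)) (A : H →L[ℂ] H)
    (hA : ∀ I J : Set Circle, IsArc I → IsArc J → 0 < ⨅ x ∈ I, ⨅ y ∈ J, edist x y →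
      IsCompactOperator (spectralProjection (L : H →L[ℂ] H) ((↑) '' I) * A *
        spectralProjection (L : H →L[ℂ] H) ((↑) '' J))) (n : ℕ) [NeZero n] :
    ∃ K : H →L[ℂ] H, IsCompactOperator K ∧
      ‖(A * (L : H →L[ℂ] H) - (L : H →L[ℂ] H) * A) - K‖ ≤ 24 * Real.pi * ‖A‖ / n := by
  classical
  have hn : (0 : ℝ) < n := by exact_mod_cast NeZero.pos n
  let S : ZMod n → Set ℂ := fun i => (↑) '' equalArc n i
  have hS : ∀ i, MeasurableSet (S i) := fun i =>
    measurableSet_coe_image_of_isArc (isArc_equalArc n i)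
  have hd : Pairwise (Function.onFun Disjoint S) := fun i j hij =>
    Set.disjoint_image_of_injective Subtype.coe_injective (pairwise_disjoint_equalArc n hij)
  have hc : spectrum ℂ (L : H →L[ℂ] H) ⊆ ⋃ i, S i := fun z hz => by
    obtain ⟨i, hi⟩ := exists_mem_equalArc n ⟨z, by
      simpa [Submonoid.unitSphere] using Unitary.spectrum_subset_circle L hz⟩
    exact Set.mem_iUnion.2 ⟨i, _, hi, rfl⟩
  set T := A * (L : H →L[ℂ] H) - (L : H →L[ℂ] H) * A with hTdef
  let P := fun i => spectralProjection (L : H →L[ℂ] H) (S i)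
  -- The `k`-th cyclic diagonal of the block matrix of `[A, L]`: its rows and columns are matched by
  -- the translation `i ↦ i + k`.
  let D : ZMod n → H →L[ℂ] H := fun k => ∑ i, P i * T * P (i + k)
  have hsum : T = ∑ k, D k := by
    have h1 : ∑ i, P i = 1 := sum_spectralProjection_eq_one L S hS hd hc
    calc T = (∑ i, P i) * T * ∑ j, P j := by rw [h1, one_mul, mul_one]
      _ = ∑ i, ∑ j, P i * T * P j := by rw [Finset.sum_mul, Finset.sum_mul_sum]
      _ = ∑ i, ∑ k, P i * T * P (i + k) := Finset.sum_congr rfl fun i _ =>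
          (Equiv.sum_comp (Equiv.addLeft i) fun j => P i * T * P j).symm
      _ = ∑ k, D k := Finset.sum_comm
  let N : Finset (ZMod n) := {0, 1, -1}
  have hN : ∀ k, k ∈ N ↔ k = 0 ∨ k = 1 ∨ k = -1 := fun k => by simp [N]
  refine ⟨∑ k ∈ Nᶜ, D k, isCompactOperator_sum _ fun k hk => isCompactOperator_sum _ fun i _ => ?_,
    ?_⟩
  · rw [Finset.mem_compl, hN, not_or, not_or] at hk
    have hK := hA _ _ (isArc_equalArc n i) (isArc_equalArc n (i + k))
      (iInf_edist_equalArc_pos i hk.1 hk.2.1 hk.2.2)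
    -- The projections commute with `L`, so the block of the commutator is the commutator of the
    -- block of `A` with `L`.
    have e : P i * T * P (i + k) =
        P i * A * P (i + k) * (L : H →L[ℂ] H) - (L : H →L[ℂ] H) * (P i * A * P (i + k)) := by
      have c1 : P i * (L : H →L[ℂ] H) = (L : H →L[ℂ] H) * P i :=
        (commute_spectralProjection L (S i)).eq
      have c2 : P (i + k) * (L : H →L[ℂ] H) = (L : H →L[ℂ] H) * P (i + k) :=
        (commute_spectralProjection L (S (i + k))).eq
      rw [mul_assoc (P i * A), c2, hTdef, mul_sub, sub_mul, ← mul_assoc (P i) (L : H →L[ℂ] H), c1]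
      simp only [mul_assoc]
    rw [e]
    exact isCompactOperator_sub (isCompactOperator_mul_right hK _)
      (isCompactOperator_mul_left hK _)
  · have e : T - ∑ k ∈ Nᶜ, D k = ∑ k ∈ N, D k := by
      rw [hsum, ← Finset.sum_add_sum_compl N D, add_sub_cancel_right]
    have hD : ∀ k ∈ N, ‖D k‖ ≤ 2 * (‖A‖ * (4 * Real.pi / n)) := fun k hk => by
      refine norm_sum_blocks_le L S hS hd hc (Equiv.addRight k) T (by positivity) fun i => ?_
      refine norm_block_commutator_le L A (hS i) (hS (i + k)) (ZMod.toCircle i) (by positivity) ?_ ?_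
      · rintro _ ⟨z, hz, rfl⟩
        exact norm_sub_toCircle_le (k := 0) (Or.inl rfl) (by rwa [add_zero])
      · rintro _ ⟨z, hz, rfl⟩
        exact norm_sub_toCircle_le ((hN k).1 hk) hz
    rw [e]
    refine (norm_sum_le_of_le N hD).trans ?_
    rw [Finset.sum_const, nsmul_eq_mul]
    -- Only an inequality: `0`, `1`, `-1` coincide partly when `n ≤ 2`. The constant is `24 = 3 · 2
    -- · 4`: three diagonals, two terms of the commutator, radius `4π/n`.
    have h3 : (N.card : ℝ) ≤ 3 := by exact_mod_cast Finset.card_le_three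
    calc (N.card : ℝ) * (2 * (‖A‖ * (4 * Real.pi / n)))
        ≤ 3 * (2 * (‖A‖ * (4 * Real.pi / n))) := by gcongr
      _ = 24 * Real.pi * ‖A‖ / n := by ring

end SpectralCalculus

theorem mainTheorem1 {H : Type*} [NormedAddCommGroup H] [InnerProductSpace ℂ H] [CompleteSpace H]
    (L : unitary (H →L[ℂ] H)) (hL : spectrum ℂ (L : H →L[ℂ] H) = Metric.sphere 0 1)
    (A : H →L[ℂ] H) :
    IsCompactOperator (A * (L : H →L[ℂ] H) - (L : H →L[ℂ] H) * A) ↔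
      ∀ I J : Set Circle, SpectralCalculus.IsArc I → SpectralCalculus.IsArc J →
        0 < ⨅ x ∈ I, ⨅ y ∈ J, edist x y →
        IsCompactOperator
          (SpectralCalculus.spectralProjection (L : H →L[ℂ] H) ((↑) '' I) * A *
            SpectralCalculus.spectralProjection (L : H →L[ℂ] H) ((↑) '' J)) := by
  refine ⟨fun h I J hI hJ hIJ => ?_, fun h => ?_⟩
  · obtain ⟨r, hr, hd⟩ := SpectralCalculus.exists_pos_le_dist_of_iInf_edist_pos hIJ
    refine SpectralCalculus.isCompactOperator_block_of_commutator L h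
      (SpectralCalculus.measurableSet_coe_image_of_isArc hI)
      (SpectralCalculus.measurableSet_coe_image_of_isArc hJ) hr ?_
    rintro _ ⟨x, hx, rfl⟩ _ ⟨y, hy, rfl⟩
    exact hd x hx y hy
  -- With `n + 1` arcs the partition is never empty; the error `24π‖A‖/(n + 1)` tends to `0`, and
  -- the compact operators are norm closed.
  · have hex := fun n : ℕ =>
      SpectralCalculus.exists_isCompactOperator_norm_commutator_sub_le L A h (n + 1)
    choose K hK hKn using hex
    refine IsClosed.mem_of_tendsto (s := {K : H →L[ℂ] H | IsCompactOperator K})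
      (SpectralCalculus.isClosed_isCompactOperator (H := H))
      (f := K) (b := Filter.atTop) ?_ (Filter.Eventually.of_forall hK)
    rw [tendsto_iff_norm_sub_tendsto_zero]
    refine squeeze_zero (fun _ => norm_nonneg _) (fun n => ?_)
      ((tendsto_const_div_atTop_nhds_zero_nat (24 * Real.pi * ‖A‖)).comp
        (Filter.tendsto_add_atTop_nat 1))
    rw [norm_sub_rev]
    exact hKn n
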